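/- Let $P\in\mathbb{C}[y]$ be a polynomial of degree at least $2$, let $\delta\in\mathbb{C}\setminus\{0\}$, and let $\theta\in(0,2\pi)\setminus\{\frac{\pi}{2},\pi,\frac{3\pi}{2}\}$. Let $h_1:\mathbb{C}^2\to\mathbb{C}^2$ be the generalized Hénon map $h_1(x,y)=(y,P(y)-\delta x)$, let $R_\theta:\mathbb{C}^2\to\mathbb{C}^2$ be the linear map $R_\theta(x,y)=(x\cos\theta-y\sin\theta,\;x\sin\theta+y\cos\theta)$, and let $h_2=R_\theta^{-1}\circ h_1\circ R_\theta$. Let $G=\langle h_1,h_2\rangle$ be the group of homeomorphisms of $\mathbb{C}^2$ generated by $h_1$ and $h_2$. Let $a_1,a_2,a_3,a_4>0$ with $a_1+a_2+a_3+a_4=1$, and let $\nu=a_1\delta_{h_1}+a_2\delta_{h_2}+a_3\delta_{h_1^{-1}}+a_4\delta_{h_2^{-1}}$, a probability measure on $G$ (here $\delta_g$ is the Dirac mass at $g$). A Borel probability measure $\mu$ on $\mathbb{C}^2$ is called $\nu$-stationary if $\mu=\int_G g_*\mu\,d\nu(g)$. For a homeomorphism $h$ of $\mathbb{C}^2$,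 let $K(h)=\{z\in\mathbb{C}^2:(h^n(z))_{n\in\mathbb{Z}}\text{ is bounded}\}$ be its filled Julia set. If $K(h_1)\cap K(h_2)=\emptyset$, then there is no $\nu$-stationary Borel probability measure on $\mathbb{C}^2$. -/

import Mathlib

open MeasureTheory
open scoped NNReal ENNReal

noncomputable section

/-- The generalized Hénon map `(x, y) ↦ (y, P(y) - δ x)` of `ℂ²`, with its polynomial inverse
`(x, y) ↦ ((P(x) - y) / δ, x)`. -/
def henonMap (P : Polynomial ℂ) (δ : ℂ) (hδ : δ ≠ 0) : (ℂ × ℂ) ≃ₜ (ℂ × ℂ) where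
  toFun z := (z.2, P.eval z.2 - δ * z.1)
  invFun z := ((P.eval z.1 - z.2) / δ, z.1)
  left_inv z := by
    ext
    · simp [hδ]
    · simp
  right_inv z := by
    ext
    · simp
    · simp only
      field_simp
      ring
  continuous_toFun := by fun_prop
  continuous_invFun := by fun_prop

/-- The complex-linear map of `ℂ²` given by the rotation matrix
`(cos θ, -sin θ; sin θ, cos θ)`. -/
def complexRotation (θ : ℝ) : (ℂ × ℂ) ≃ₜ (ℂ × ℂ) where
  toFun z := (Real.cos θ * z.1 - Real.sin θ * z.2, Real.sin θ * z.1 + Real.cos θ * z.2)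
  invFun z := (Real.cos θ * z.1 + Real.sin θ * z.2, -Real.sin θ * z.1 + Real.cos θ * z.2)
  left_inv z := by
    have h : (Real.cos θ : ℂ) ^ 2 + (Real.sin θ : ℂ) ^ 2 = 1 := by
      exact_mod_cast Real.cos_sq_add_sin_sq θ
    ext
    · simp only
      linear_combination z.1 * h
    · simp only
      linear_combination z.2 * h
  right_inv z := by
    have h : (Real.cos θ : ℂ) ^ 2 + (Real.sin θ : ℂ) ^ 2 = 1 := by
      exact_mod_cast Real.cos_sq_add_sin_sq θ
    ext
    · simp only
      linear_combination z.1 * h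
    · simp only
      linear_combination z.2 * h
  continuous_toFun := by fun_prop
  continuous_invFun := by fun_prop

/-- The rotated Hénon map `R_θ⁻¹ ∘ h ∘ R_θ`, where `h(x, y) = (y, P(y) - δ x)`
(the product of homeomorphisms is composition). -/
def rotatedHenonMap (P : Polynomial ℂ) (δ : ℂ) (hδ : δ ≠ 0) (θ : ℝ) : (ℂ × ℂ) ≃ₜ (ℂ × ℂ) :=
  (complexRotation θ)⁻¹ * henonMap P δ hδ * complexRotation θ

/-- The filled Julia set `K(h)`: the points whose full orbit `(hⁿ(z))`, `n ∈ ℤ`, is bounded. -/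
def filledJuliaSet (h : (ℂ × ℂ) ≃ₜ (ℂ × ℂ)) : Set (ℂ × ℂ) :=
  {z | Bornology.IsBounded (Set.range fun n : ℤ => (h ^ n) z)}

/-- The group `G = ⟨h₁, h₂⟩` generated by the Hénon map and the rotated Hénon map. -/
def henonGroup (P : Polynomial ℂ) (δ : ℂ) (hδ : δ ≠ 0) (θ : ℝ) :
    Subgroup ((ℂ × ℂ) ≃ₜ (ℂ × ℂ)) :=
  Subgroup.closure {henonMap P δ hδ, rotatedHenonMap P δ hδ θ}

/-- `G` is a countable discrete group, so all its subsets are measurable. -/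
instance henonGroup.instMeasurableSpace (P : Polynomial ℂ) (δ : ℂ) (hδ : δ ≠ 0) (θ : ℝ) :
    MeasurableSpace (henonGroup P δ hδ θ) := ⊤

/-- The natural action of `G` on `ℂ²`. -/
instance henonGroup.instMulAction (P : Polynomial ℂ) (δ : ℂ) (hδ : δ ≠ 0) (θ : ℝ) :
    MulAction (henonGroup P δ hδ θ) (ℂ × ℂ) where
  smul g z := (g : (ℂ × ℂ) ≃ₜ (ℂ × ℂ)) z
  one_smul _ := rfl
  mul_smul _ _ _ := rfl

/-- The first generator `h₁`, as an element of `G`. -/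
def henonGroup.gen₁ (P : Polynomial ℂ) (δ : ℂ) (hδ : δ ≠ 0) (θ : ℝ) : henonGroup P δ hδ θ :=
  ⟨henonMap P δ hδ, Subgroup.subset_closure (Set.mem_insert _ _)⟩

/-- The second generator `h₂`, as an element of `G`. -/
def henonGroup.gen₂ (P : Polynomial ℂ) (δ : ℂ) (hδ : δ ≠ 0) (θ : ℝ) : henonGroup P δ hδ θ :=
  ⟨rotatedHenonMap P δ hδ θ, Subgroup.subset_closure (Set.mem_insert_of_mem _ rfl)⟩

/-- The measure `ν = a₁ δ_{h₁} + a₂ δ_{h₂} + a₃ δ_{h₁⁻¹} + a₄ δ_{h₂⁻¹}` on `G`. -/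
def stepMeasure (P : Polynomial ℂ) (δ : ℂ) (hδ : δ ≠ 0) (θ : ℝ) (a₁ a₂ a₃ a₄ : ℝ≥0) :
    Measure (henonGroup P δ hδ θ) :=
  a₁ • Measure.dirac (henonGroup.gen₁ P δ hδ θ) +
  a₂ • Measure.dirac (henonGroup.gen₂ P δ hδ θ) +
  a₃ • Measure.dirac (henonGroup.gen₁ P δ hδ θ)⁻¹ +
  a₄ • Measure.dirac (henonGroup.gen₂ P δ hδ θ)⁻¹

/-- For a group `Γ` acting on `X`, the measure `μ` on `X` is `ν`-stationary if
`μ = ∫ g_* μ dν(g)`, as an identity of values on measurable sets. -/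
def IsStationaryMeasure {Γ X : Type*} [Group Γ] [MeasurableSpace Γ] [MeasurableSpace X] [MulAction Γ X]
    (ν : Measure Γ) (μ : Measure X) : Prop :=
  ∀ B : Set X, MeasurableSet B → μ B = ∫⁻ g, (μ.map fun x => g • x) B ∂ν

end

/-! Far from the origin each of h₁, h₂ and their inverses doubles the norm except near the kernel of
one linear form. The four kernels are distinct because sin θ and cos θ are nonzero, so outside some
ball of radius R at most one of the four steps fails to double the norm
(`exists_forall_ne_two_mul_norm_le`), as for reduced words in a free group. Hence a far point has at
most one step that halves its norm. Multiplying weights τ along successive halvings gives a function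
0 < u ≤ 1, equal to 1 on the ball, with ∑ aᵢ u(fᵢ x) ≤ κ u(x) and κ < 1 outside it
(`sum_descentWeight_le`, `exists_descent_weights`). Integrating against a stationary μ forces ∫ u =
0 outside the ball, so μ is carried by the ball. Stationarity with positive aᵢ also makes preimages
of null sets null, so the points whose h₁-orbit or h₂-orbit leaves the ball form a null set. As
K(h₁) and K(h₂) are disjoint, every point is of this kind. -/

section Escape

/-! ### A superharmonic function from descent of the height -/

variable {X ι : Type*} [Fintype ι]

/-- Iterates of the operator sending `v` to the function equal to `τ i * v (f i x)` where `f i`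
at least halves the height `N` above the level `R`, and to `1` elsewhere. -/
noncomputable def descentWeightAux (f : ι → X → X) (N : X → ℝ) (R : ℝ) (τ : ι → ℝ≥0) :
    ℕ → X → ℝ≥0∞
  -- Starting from 0, a descent not finished within n levels contributes 0, so the supremum over n
  -- picks up the completed product.
  | 0, _ => 0
  | n + 1, x => by
      classical
      exact ∏ i, if R < N x ∧ 2 * N (f i x) ≤ N x then
        (τ i : ℝ≥0∞) * descentWeightAux f N R τ n (f i x) else 1

/-- The product of the weights `τ` along the halving descent of `x` to a point without descent. -/
noncomputable def descentWeight (f : ι → X → X) (N : X → ℝ) (R : ℝ) (τ : ι → ℝ≥0) (x : X) :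
    ℝ≥0∞ := ⨆ n, descentWeightAux f N R τ n x

variable {f : ι → X → X} {N : X → ℝ} {R : ℝ} {τ : ι → ℝ≥0}

theorem descentWeightAux_le_one (hτ : ∀ i, τ i ≤ 1) (n : ℕ) (x : X) :
    descentWeightAux f N R τ n x ≤ 1 := by
  classical
  induction n generalizing x with
  | zero => simp [descentWeightAux]
  | succ n ih =>
    refine Finset.prod_le_one' fun i _ => ?_
    split_ifs
    · exact mul_le_one' (by exact_mod_cast hτ i) (ih _)
    · exact le_rfl

theorem descentWeight_le_one (hτ : ∀ i, τ i ≤ 1) (x : X) : descentWeight f N R τ x ≤ 1 :=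
  iSup_le fun n => descentWeightAux_le_one hτ n x

/-- Each descent step halves the height, so a descent starting below 2ⁿR ends within n steps and
only finitely many positive weights are multiplied. -/
theorem descentWeight_pos (hR : 0 < R) (hτ : ∀ i, 0 < τ i) (x : X) :
    0 < descentWeight f N R τ x := by
  classical
  have key : ∀ (n : ℕ) (x : X), N x ≤ 2 ^ n * R → 0 < descentWeightAux f N R τ (n + 1) x := by
    intro n
    induction n with
    | zero =>
      intro x hx
      have : ¬ R < N x := by simpa using hx
      simp [descentWeightAux, this]
    | succ n ih =>
      intro x hx
      rw [descentWeightAux, pos_iff_ne_zero, Finset.prod_ne_zero_iff]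
      intro i _
      split_ifs with h
      · refine mul_ne_zero (by exact_mod_cast (hτ i).ne') (ih _ ?_).ne'
        rw [pow_succ] at hx
        linarith [h.2]
      · exact one_ne_zero
  obtain ⟨n, hn⟩ := pow_unbounded_of_one_lt (N x / R) (one_lt_two (α := ℝ))
  exact (key n x ((div_lt_iff₀ hR).1 hn).le).trans_le
    (le_iSup (fun n => descentWeightAux f N R τ n x) (n + 1))

theorem measurable_descentWeight [MeasurableSpace X] (hf : ∀ i, Measurable (f i))
    (hN : Measurable N) : Measurable (descentWeight f N R τ) := by
  classical
  refine Measurable.iSup fun n => ?_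
  induction n with
  | zero => exact measurable_const
  | succ n ih =>
    refine Finset.measurable_prod _ fun i _ => Measurable.ite ?_ ?_ measurable_const
    · exact (measurableSet_lt measurable_const hN).inter
        (measurableSet_le ((hN.comp (hf i)).const_mul 2) hN)
    · exact (ih.comp (hf i)).const_mul _

theorem descentWeight_eq_iSup_succ (x : X) :
    descentWeight f N R τ x = ⨆ n, descentWeightAux f N R τ (n + 1) x := by
  rw [descentWeight, ← sup_iSup_nat_succ]
  simp [descentWeightAux]

theorem descentWeight_eq_one (x : X) (h : ∀ i, ¬ (R < N x ∧ 2 * N (f i x) ≤ N x)) :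
    descentWeight f N R τ x = 1 := by
  rw [descentWeight_eq_iSup_succ]
  simp [descentWeightAux, h]

/-- The other steps double a positive height, so they cannot halve it and all their factors in the
product are 1. -/
theorem descentWeight_eq_mul (hR : 0 < R) (x : X) (i : ι) (h : R < N x ∧ 2 * N (f i x) ≤ N x)
    (hi : ∀ j, j ≠ i → 2 * N x ≤ N (f j x)) :
    descentWeight f N R τ x = τ i * descentWeight f N R τ (f i x) := by
  classical
  rw [descentWeight_eq_iSup_succ, descentWeight, ENNReal.mul_iSup]
  refine iSup_congr fun n => ?_
  rw [descentWeightAux, Finset.prod_eq_single i, if_pos h]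
  · intro j _ hj
    rw [if_neg]
    rintro ⟨h1, h2⟩
    linarith [hi j hj]
  · simp

/-- Contraction of the descent weight, on average, above the level `R`. -/
theorem sum_descentWeight_le [DecidableEq ι] (hR : 0 < R) (hτ0 : ∀ i, 0 < τ i)
    (hτ : ∀ i, τ i ≤ 1)
    {inv : ι → ι} (hinv : ∀ i x, f (inv i) (f i x) = x)
    (hQ : ∀ x, R < N x → ∃ i, ∀ j, j ≠ i → 2 * N x ≤ N (f j x))
    {a : ι → ℝ≥0} {κ : ℝ≥0}
    (hκ : ∀ i, ∑ j ∈ Finset.univ.erase i, a j * τ (inv j) + a i * (τ i)⁻¹ ≤ κ)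
    (x : X) (hx : R < N x) :
    ∑ i, a i * descentWeight f N R τ (f i x) ≤ κ * descentWeight f N R τ x := by
  obtain ⟨i, hi⟩ := hQ x hx
  -- After a doubling step j, undoing j is a halving, hence the unique descent from `f j x`.
  have hgood : ∀ j, j ≠ i → descentWeight f N R τ (f j x) =
      τ (inv j) * descentWeight f N R τ x := by
    intro j hj
    have hjx := hi j hj
    have hjR : R < N (f j x) := by linarith
    have hd : R < N (f j x) ∧ 2 * N (f (inv j) (f j x)) ≤ N (f j x) := by
      rw [hinv]; exact ⟨hjR, hjx⟩
    obtain ⟨k, hk⟩ := hQ _ hjR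
    have hki : inv j = k := by
      by_contra hne
      linarith [hk _ hne, hd.2]
    rw [descentWeight_eq_mul hR (f j x) (inv j) hd (by rw [hki]; exact hk), hinv]
  -- Either i is the descent from x, and equality holds, or x has no descent and its weight is 1,
  -- while the left side is at most 1 ≤ τᵢ⁻¹.
  have hbad : descentWeight f N R τ (f i x) ≤ ((τ i)⁻¹ : ℝ≥0) * descentWeight f N R τ x := by
    by_cases h : 2 * N (f i x) ≤ N x
    · rw [descentWeight_eq_mul hR x i ⟨hx, h⟩ hi, ← mul_assoc, ← ENNReal.coe_mul,
        inv_mul_cancel₀ (hτ0 i).ne', ENNReal.coe_one, one_mul]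
    · rw [descentWeight_eq_one x, mul_one]
      · refine (descentWeight_le_one hτ _).trans ?_
        exact_mod_cast (one_le_inv₀ (hτ0 i)).2 (hτ i)
      · rintro j ⟨-, hj⟩
        by_cases hji : j = i
        · exact h (hji ▸ hj)
        · linarith [hi j hji]
  rw [← Finset.sum_erase_add _ _ (Finset.mem_univ i)]
  calc _ ≤ ∑ j ∈ Finset.univ.erase i, (a j : ℝ≥0∞) * (τ (inv j) * descentWeight f N R τ x)
        + a i * (((τ i)⁻¹ : ℝ≥0) * descentWeight f N R τ x) := by
        refine add_le_add (Finset.sum_le_sum fun j hj => ?_) (by gcongr)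
        rw [hgood j (Finset.ne_of_mem_erase hj)]
    _ = ((∑ j ∈ Finset.univ.erase i, a j * τ (inv j) + a i * (τ i)⁻¹ : ℝ≥0) : ℝ≥0∞) *
        descentWeight f N R τ x := by
        push_cast
        simp only [add_mul, Finset.sum_mul, mul_assoc]
    _ ≤ _ := by
        gcongr
        exact hκ i

/-- A stationary probability measure of a random walk by maps `f i`, at most one of which fails to
double the height `N` of a given point above level `R`, does not charge the points above `R`. -/
theorem measure_height_gt_eq_zero [DecidableEq ι] [MeasurableSpace X] {μ : Measure X}
    [IsProbabilityMeasure μ] (hf : ∀ i, Measurable (f i)) (hN : Measurable N)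
    (hR : 0 < R) (hτ0 : ∀ i, 0 < τ i) (hτ : ∀ i, τ i ≤ 1)
    {inv : ι → ι} (hinv : ∀ i x, f (inv i) (f i x) = x)
    (hQ : ∀ x, R < N x → ∃ i, ∀ j, j ≠ i → 2 * N x ≤ N (f j x))
    {a : ι → ℝ≥0} (ha : ∑ i, a i = 1) {κ : ℝ≥0} (hκ1 : κ < 1)
    (hκ : ∀ i, ∑ j ∈ Finset.univ.erase i, a j * τ (inv j) + a i * (τ i)⁻¹ ≤ κ)
    (hμ : μ = ∑ i, a i • μ.map (f i)) :
    μ {x | R < N x} = 0 := by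
  set u := descentWeight f N R τ with hu
  have humeas : Measurable u := measurable_descentWeight hf hN
  have hF : MeasurableSet {x | R < N x} := measurableSet_lt measurable_const hN
  have hint : ∫⁻ x, u x ∂μ = ∫⁻ x, ∑ i, a i * u (f i x) ∂μ := by
    conv_lhs => rw [hμ]
    have hc : ∀ i, Measurable fun x => (a i : ℝ≥0∞) * u (f i x) := fun i =>
      (humeas.comp (hf i)).const_mul _
    rw [lintegral_finsetSum_measure, lintegral_finsetSum _ fun i _ => hc i]
    refine Finset.sum_congr rfl fun i _ => ?_
    rw [lintegral_smul_measure, lintegral_map humeas (hf i),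
      lintegral_const_mul _ (show Measurable fun x => u (f i x) from humeas.comp (hf i))]
    rfl
  have hu1 : ∀ x, u x ≤ 1 := descentWeight_le_one hτ
  have hle : ∫⁻ x, u x ∂μ ≤ ∫⁻ x in {x | R < N x}ᶜ, u x ∂μ +
      κ * ∫⁻ x in {x | R < N x}, u x ∂μ := by
    rw [hint, ← lintegral_add_compl _ hF, add_comm, ← lintegral_const_mul _ humeas]
    refine add_le_add (setLIntegral_mono humeas fun x hx => ?_)
      (setLIntegral_mono (humeas.const_mul _) fun x hx =>
        sum_descentWeight_le hR hτ0 hτ hinv hQ hκ x hx)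
    rw [hu, descentWeight_eq_one x fun i h => hx h.1]
    calc ∑ i, (a i : ℝ≥0∞) * u (f i x) ≤ ∑ i, (a i : ℝ≥0∞) :=
          Finset.sum_le_sum fun i _ => mul_le_of_le_one_right' (hu1 _)
      _ = 1 := by exact_mod_cast ha
  have hfin : ∫⁻ x, u x ∂μ ≠ ∞ := by
    refine ne_top_of_le_ne_top ENNReal.one_ne_top ((lintegral_mono hu1).trans ?_)
    simp
  have hfin' : ∀ s, ∫⁻ x in s, u x ∂μ ≠ ∞ := fun s =>
    ne_top_of_le_ne_top hfin (setLIntegral_le_lintegral _ _)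
  have hzero : ∫⁻ x in {x | R < N x}, u x ∂μ = 0 := by
    rw [← lintegral_add_compl _ hF, add_comm] at hle
    have h2 := (ENNReal.add_le_add_iff_left (hfin' _)).1 hle
    by_contra h0
    have h3 := ENNReal.mul_lt_mul_left h0 (hfin' _) (c := _) (ENNReal.coe_lt_one_iff.2 hκ1)
    simp only [one_mul] at h3
    exact absurd h2 (not_le.2 h3)
  rw [setLIntegral_eq_zero_iff hF humeas] at hzero
  refine measure_mono_null (fun x hx => ?_) (ae_iff.1 hzero)
  simpa [hu] using ⟨hx, (descentWeight_pos hR hτ0 x).ne'⟩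

end Escape

/-! ### Choice of the weights -/

section Weights

/-- At η = 0 the left side is m + 2m' + M ≤ 1, with equality when m' = M'. The perturbation by η
restores strictness: the last term grows by less than 2η, which the bound m' + M' - 2η on the middle
term absorbs, and the first term drops below m. -/
theorem div_one_sub_lt {m M m' M' η : ℝ} (hm : 0 < m) (hm' : m' ≤ M')
    (hη : 0 < η) (hηM : 4 * η ≤ M) (hηM' : 4 * η ≤ M') (hsum : m + M + (m' + M') = 1) :
    m * (1 - η / M) + 2 * (m' * (1 - η / M')) + M / (1 - η / M) < 1 := by
  have hM : 0 < M := by linarith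
  have hM' : 0 < M' := by linarith
  have e : η / M ≤ 1 / 4 := by rw [div_le_iff₀ hM]; linarith
  have e0 : 0 < η / M := by positivity
  have h1 : M / (1 - η / M) < M + 2 * η := by
    rw [div_lt_iff₀ (by linarith)]
    have : M * (η / M) = η := by field_simp
    nlinarith
  have h2 : 2 * (m' * (1 - η / M')) ≤ m' + M' - 2 * η := by
    have hs : M' * (η / M') = η := by field_simp
    have e' : η / M' ≤ 1 / 4 := by rw [div_le_iff₀ hM']; linarith
    nlinarith [mul_nonneg (sub_nonneg.2 hm') (sub_nonneg.2 e')]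
  nlinarith [mul_pos hm e0]

theorem mul_div_min_mul (a b : ℝ) (c : ℝ) (ha : 0 < a) (hb : 0 < b) :
    a * b / (min a b * c) = max a b / c := by
  rw [← min_mul_max a b, mul_div_mul_left _ _ (lt_min ha hb).ne']

/-- Weights less than one for which the walk on the free group with step probabilities `aᵢ` has a
strictly superharmonic function that is multiplicative along reduced words. -/
theorem exists_descent_weights (a₁ a₂ a₃ a₄ : ℝ≥0) (ha₁ : 0 < a₁) (ha₂ : 0 < a₂) (ha₃ : 0 < a₃)
    (ha₄ : 0 < a₄) (ha : a₁ + a₂ + a₃ + a₄ = 1) :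
    ∃ (τ : Fin 4 → ℝ≥0) (κ : ℝ≥0), κ < 1 ∧ (∀ i, 0 < τ i) ∧ (∀ i, τ i ≤ 1) ∧
      ∀ i, ∑ j ∈ Finset.univ.erase i, ![a₁, a₂, a₃, a₄] j * τ (j + 2) +
        ![a₁, a₂, a₃, a₄] i * (τ i)⁻¹ ≤ κ := by
  have hs : (a₁ : ℝ) + a₂ + a₃ + a₄ = 1 := by exact_mod_cast ha
  have hr₁ : (0 : ℝ) < a₁ := ha₁
  have hr₂ : (0 : ℝ) < a₂ := ha₂
  have hr₃ : (0 : ℝ) < a₃ := ha₃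
  have hr₄ : (0 : ℝ) < a₄ := ha₄
  set m : ℝ := min a₁ a₃ with hm
  set M : ℝ := max a₁ a₃ with hM
  set m' : ℝ := min a₂ a₄ with hm'
  set M' : ℝ := max a₂ a₄ with hM'
  have hm0 : 0 < m := lt_min hr₁ hr₃
  have hm0' : 0 < m' := lt_min hr₂ hr₄
  have hM0 : 0 < M := lt_max_of_lt_left hr₁
  have hM0' : 0 < M' := lt_max_of_lt_left hr₂
  have hsum : m + M + (m' + M') = 1 := by
    rw [hm, hM, hm', hM', min_add_max, min_add_max]; linarith
  obtain ⟨η, hη, hηM, hηM'⟩ : ∃ η : ℝ, 0 < η ∧ 4 * η ≤ M ∧ 4 * η ≤ M' :=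
    ⟨min M M' / 4, by positivity, by linarith [min_le_left M M'], by linarith [min_le_right M M']⟩
  have hc : 0 < 1 - η / M := by rw [sub_pos, div_lt_one hM0]; linarith
  have hc' : 0 < 1 - η / M' := by rw [sub_pos, div_lt_one hM0']; linarith
  have hx : m * (1 - η / M) ≤ m := mul_le_of_le_one_right hm0.le (by linarith [div_pos hη hM0])
  have hx' : m' * (1 - η / M') ≤ m' :=
    mul_le_of_le_one_right hm0'.le (by linarith [div_pos hη hM0'])
  have hB := div_one_sub_lt hm0 (min_le_max : m' ≤ M') hη hηM hηM' hsum
  have hB' := div_one_sub_lt hm0' (min_le_max : m ≤ M) hη hηM' hηM (by linarith)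
  have hD := mul_div_min_mul a₁ a₃ (1 - η / M) hr₁ hr₃
  have hD' := mul_div_min_mul a₂ a₄ (1 - η / M') hr₂ hr₄
  rw [← hm, ← hM] at hD
  rw [← hm', ← hM'] at hD'
  have hx0 : 0 < m * (1 - η / M) := mul_pos hm0 hc
  have hx0' : 0 < m' * (1 - η / M') := mul_pos hm0' hc'
  have hxa₁ : m * (1 - η / M) ≤ a₁ := hx.trans (min_le_left _ _)
  have hxa₃ : m * (1 - η / M) ≤ a₃ := hx.trans (min_le_right _ _)
  have hxa₂ : m' * (1 - η / M') ≤ a₂ := hx'.trans (min_le_left _ _)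
  have hxa₄ : m' * (1 - η / M') ≤ a₄ := hx'.trans (min_le_right _ _)
  generalize m * (1 - η / M) = x at *
  generalize m' * (1 - η / M') = x' at *
  lift x to ℝ≥0 using hx0.le
  lift x' to ℝ≥0 using hx0'.le
  norm_cast at hx0 hx0' hxa₁ hxa₂ hxa₃ hxa₄
  -- With inversion i ↦ i + 2, this makes each product of aⱼ with the weight of the inverse step
  -- equal to x or x', the same for a step and its inverse.
  set τ : Fin 4 → ℝ≥0 := ![x / a₃, x' / a₄, x / a₁, x' / a₂] with hτ
  refine ⟨τ, Finset.univ.sup fun i => ∑ j ∈ Finset.univ.erase i,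
    ![a₁, a₂, a₃, a₄] j * τ (j + 2) + ![a₁, a₂, a₃, a₄] i * (τ i)⁻¹, ?_, ?_, ?_, fun i =>
      Finset.le_sup (f := fun i => ∑ j ∈ Finset.univ.erase i,
        ![a₁, a₂, a₃, a₄] j * τ (j + 2) + ![a₁, a₂, a₃, a₄] i * (τ i)⁻¹) (Finset.mem_univ i)⟩
  · have hprod : ∀ j, ((![a₁, a₂, a₃, a₄] j * τ (j + 2) : ℝ≥0) : ℝ) = ![(x : ℝ), x', x, x'] j := by
      intro j
      fin_cases j <;> simp [hτ] <;> field_simp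
    rw [Finset.sup_lt_iff one_pos]
    intro i _
    rw [← NNReal.coe_lt_coe, NNReal.coe_add, NNReal.coe_sum, Finset.sum_congr rfl fun j _ => hprod j,
      Finset.sum_erase_eq_sub (Finset.mem_univ i), Fin.sum_univ_four]
    have hinv : ((![a₁, a₂, a₃, a₄] i * (τ i)⁻¹ : ℝ≥0) : ℝ) =
        ![(a₁ * a₃ / x : ℝ), a₂ * a₄ / x', a₁ * a₃ / x, a₂ * a₄ / x'] i := by
      fin_cases i <;> simp [hτ] <;> field_simp
    rw [hinv]
    fin_cases i <;> simp <;> linarith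
  · intro i
    fin_cases i <;> simp [hτ] <;> positivity
  · intro i
    fin_cases i <;> simp [hτ] <;> exact div_le_one_of_le₀ ‹_› zero_le

end Weights

/-! ### Expansion of Hénon maps near infinity -/

theorem Polynomial.exists_mul_norm_le_norm_eval {P : Polynomial ℂ} (hP : 2 ≤ P.natDegree)
    (K : ℝ) : ∃ r : ℝ, ∀ w : ℂ, r ≤ ‖w‖ → K * ‖w‖ ≤ ‖P.eval w‖ := by
  have hlt : (Polynomial.C (K : ℂ) * Polynomial.X).degree < P.degree := by
    refine (Polynomial.degree_C_mul_X_le _).trans_lt ?_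
    rw [Polynomial.degree_eq_natDegree (by rintro rfl; simp at hP)]
    exact_mod_cast hP
  have h := (Polynomial.isLittleO_cobounded_of_degree_lt hlt).bound one_pos
  rw [← comap_norm_atTop, Filter.eventually_comap] at h
  obtain ⟨r, hr⟩ := Filter.eventually_atTop.1 h
  refine ⟨r, fun w hw => ?_⟩
  have h1 := hr _ hw w rfl
  simp only [Polynomial.eval_mul, Polynomial.eval_C, Polynomial.eval_X, norm_mul,
    Complex.norm_real, Real.norm_eq_abs, one_mul] at h1
  exact (mul_le_mul_of_nonneg_right (le_abs_self K) (norm_nonneg w)).trans h1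

/-- At most one of the four maps fails to double the norm of a large vector. -/
theorem exists_forall_ne_two_mul_norm_le {ι : Type*} {f : ι → ℂ × ℂ → ℂ × ℂ}
    {ℓ : ι → ℂ × ℂ → ℂ} [Finite ι] [Nonempty ι] {κ : ℝ} (hκ : 0 < κ)
    (hℓ : ∀ i j, i ≠ j → ∀ z, κ * ‖z‖ ≤ ‖ℓ i z‖ + ‖ℓ j z‖)
    (hf : ∀ i, ∀ ε > 0, ∃ R, ∀ z, R < ‖z‖ → ε * ‖z‖ ≤ ‖ℓ i z‖ → 2 * ‖z‖ ≤ ‖f i z‖) :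
    ∃ R > 0, ∀ z, R < ‖z‖ → ∃ i, ∀ j, j ≠ i → 2 * ‖z‖ ≤ ‖f j z‖ := by
  -- If two steps failed to double, both forms would be below κ/3 · ‖z‖, contradicting the lower
  -- bound κ‖z‖ on their sum.
  choose R hR using fun i => hf i (κ / 3) (by positivity)
  obtain ⟨B, hB⟩ := (Set.finite_range R).bddAbove
  refine ⟨max B 1, by positivity, fun z hz => ?_⟩
  have hzR : ∀ i, R i < ‖z‖ := fun i =>
    (hB ⟨i, rfl⟩).trans_lt ((le_max_left _ _).trans_lt hz)
  have hz0 : 0 < ‖z‖ := lt_of_lt_of_le (by positivity) hz.le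
  by_cases h : ∃ i, ‖f i z‖ < 2 * ‖z‖
  · obtain ⟨i, hi⟩ := h
    refine ⟨i, fun j hj => hR j z (hzR j) ?_⟩
    by_contra! hlt
    have h1 := hℓ i j hj.symm z
    have h2 : ‖ℓ i z‖ < κ / 3 * ‖z‖ := by
      by_contra! hge
      exact absurd (hR i z (hzR i) hge) (not_le.2 hi)
    nlinarith
  · push Not at h
    exact ⟨Classical.arbitrary ι, fun j _ => h j⟩

theorem henonMap_apply (P : Polynomial ℂ) (δ : ℂ) (hδ : δ ≠ 0) (z : ℂ × ℂ) :
    henonMap P δ hδ z = (z.2, P.eval z.2 - δ * z.1) := rfl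

theorem henonMap_inv_apply (P : Polynomial ℂ) (δ : ℂ) (hδ : δ ≠ 0) (z : ℂ × ℂ) :
    (henonMap P δ hδ)⁻¹ z = ((P.eval z.1 - z.2) / δ, z.1) := rfl

theorem complexRotation_apply (θ : ℝ) (z : ℂ × ℂ) : complexRotation θ z =
    (Real.cos θ * z.1 - Real.sin θ * z.2, Real.sin θ * z.1 + Real.cos θ * z.2) := rfl

theorem complexRotation_inv_apply (θ : ℝ) (z : ℂ × ℂ) : (complexRotation θ)⁻¹ z =
    (Real.cos θ * z.1 + Real.sin θ * z.2, -Real.sin θ * z.1 + Real.cos θ * z.2) := rfl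

theorem rotatedHenonMap_apply (P : Polynomial ℂ) (δ : ℂ) (hδ : δ ≠ 0) (θ : ℝ) (z : ℂ × ℂ) :
    rotatedHenonMap P δ hδ θ z =
      (complexRotation θ)⁻¹ (henonMap P δ hδ (complexRotation θ z)) := rfl

theorem rotatedHenonMap_inv_apply (P : Polynomial ℂ) (δ : ℂ) (hδ : δ ≠ 0) (θ : ℝ) (z : ℂ × ℂ) :
    (rotatedHenonMap P δ hδ θ)⁻¹ z =
      (complexRotation θ)⁻¹ ((henonMap P δ hδ)⁻¹ (complexRotation θ z)) := rfl

theorem norm_real_mul_add_le {s t : ℝ} (hs : |s| ≤ 1) (ht : |t| ≤ 1) (z : ℂ × ℂ) :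
    ‖(s : ℂ) * z.1 + t * z.2‖ ≤ 2 * ‖z‖ := by
  refine (norm_add_le _ _).trans ?_
  rw [norm_mul, norm_mul, Complex.norm_real, Complex.norm_real, Real.norm_eq_abs, Real.norm_eq_abs]
  have h1 := mul_le_mul hs (norm_fst_le z) (norm_nonneg _) zero_le_one
  have h2 := mul_le_mul ht (norm_snd_le z) (norm_nonneg _) zero_le_one
  linarith

theorem norm_complexRotation_le (θ : ℝ) (z : ℂ × ℂ) : ‖complexRotation θ z‖ ≤ 2 * ‖z‖ := by
  rw [complexRotation_apply, Prod.norm_def]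
  refine max_le ?_ (norm_real_mul_add_le (Real.abs_sin_le_one _) (Real.abs_cos_le_one _) z)
  simpa [sub_eq_add_neg] using norm_real_mul_add_le (s := Real.cos θ) (t := -Real.sin θ)
    (Real.abs_cos_le_one _) (by simpa using Real.abs_sin_le_one θ) z

theorem norm_complexRotation_inv_le (θ : ℝ) (z : ℂ × ℂ) :
    ‖(complexRotation θ)⁻¹ z‖ ≤ 2 * ‖z‖ := by
  rw [complexRotation_inv_apply, Prod.norm_def]
  refine max_le (norm_real_mul_add_le (Real.abs_cos_le_one _) (Real.abs_sin_le_one _) z) ?_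
  simpa using norm_real_mul_add_le (s := -Real.sin θ) (t := Real.cos θ)
    (by simpa using Real.abs_sin_le_one θ) (Real.abs_cos_le_one _) z

theorem norm_le_two_mul_norm_complexRotation (θ : ℝ) (z : ℂ × ℂ) :
    ‖z‖ ≤ 2 * ‖complexRotation θ z‖ := by
  simpa using norm_complexRotation_inv_le θ (complexRotation θ z)

theorem norm_le_two_mul_norm_complexRotation_inv (θ : ℝ) (z : ℂ × ℂ) :
    ‖z‖ ≤ 2 * ‖(complexRotation θ)⁻¹ z‖ := by
  simpa using norm_complexRotation_le θ ((complexRotation θ)⁻¹ z)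

theorem exists_mul_norm_le_norm_henonMap {P : Polynomial ℂ} (hP : 2 ≤ P.natDegree) {δ : ℂ}
    (hδ : δ ≠ 0) (K : ℝ) {ε : ℝ} (hε : 0 < ε) :
    ∃ R, ∀ z, R < ‖z‖ → ε * ‖z‖ ≤ ‖z.2‖ → K * ‖z‖ ≤ ‖henonMap P δ hδ z‖ := by
  obtain ⟨r, hr⟩ := P.exists_mul_norm_le_norm_eval hP ((|K| + ‖δ‖) / ε)
  refine ⟨r / ε, fun z hz hz2 => ?_⟩
  rw [div_lt_iff₀ hε] at hz
  have h1 := hr z.2 (by linarith)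
  have h2 : (|K| + ‖δ‖) * ‖z‖ ≤ (|K| + ‖δ‖) / ε * ‖z.2‖ := by
    rw [div_mul_eq_mul_div, le_div_iff₀ hε, mul_assoc, mul_comm ‖z‖]
    gcongr
  have h3 : ‖P.eval z.2‖ - ‖δ * z.1‖ ≤ ‖P.eval z.2 - δ * z.1‖ := norm_sub_norm_le _ _
  have h4 : ‖δ * z.1‖ ≤ ‖δ‖ * ‖z‖ := by
    rw [norm_mul]; gcongr; exact norm_fst_le z
  have h5 := norm_snd_le (henonMap P δ hδ z)
  rw [henonMap_apply] at h5 ⊢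
  simp only at h5
  have h6 : K * ‖z‖ ≤ |K| * ‖z‖ := by gcongr; exact le_abs_self K
  linarith

theorem exists_mul_norm_le_norm_henonMap_inv {P : Polynomial ℂ} (hP : 2 ≤ P.natDegree) {δ : ℂ}
    (hδ : δ ≠ 0) (K : ℝ) {ε : ℝ} (hε : 0 < ε) :
    ∃ R, ∀ z, R < ‖z‖ → ε * ‖z‖ ≤ ‖z.1‖ → K * ‖z‖ ≤ ‖(henonMap P δ hδ)⁻¹ z‖ := by
  obtain ⟨r, hr⟩ := P.exists_mul_norm_le_norm_eval hP ((|K| * ‖δ‖ + 1) / ε)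
  refine ⟨r / ε, fun z hz hz2 => ?_⟩
  rw [div_lt_iff₀ hε] at hz
  have h1 := hr z.1 (by linarith)
  have h2 : (|K| * ‖δ‖ + 1) * ‖z‖ ≤ (|K| * ‖δ‖ + 1) / ε * ‖z.1‖ := by
    rw [div_mul_eq_mul_div, le_div_iff₀ hε, mul_assoc, mul_comm ‖z‖]
    gcongr
  have h3 : ‖P.eval z.1‖ - ‖z.2‖ ≤ ‖P.eval z.1 - z.2‖ := norm_sub_norm_le _ _
  have h4 := norm_snd_le z
  have h5 := norm_fst_le ((henonMap P δ hδ)⁻¹ z)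
  rw [henonMap_inv_apply] at h5 ⊢
  simp only at h5
  have h6 : K * ‖z‖ ≤ |K| * ‖z‖ := by gcongr; exact le_abs_self K
  refine le_trans (h6.trans ?_) h5
  rw [norm_div, le_div_iff₀ (norm_pos_iff.2 hδ)]
  linarith

/-- Expansion off a cone is inherited by a conjugate by a complex rotation. -/
theorem exists_two_mul_norm_le_of_conj (θ : ℝ) {f : ℂ × ℂ → ℂ × ℂ} {ℓ : ℂ × ℂ → ℂ}
    (hf : ∀ ε > 0, ∃ R, ∀ z, R < ‖z‖ → ε * ‖z‖ ≤ ‖ℓ z‖ → 8 * ‖z‖ ≤ ‖f z‖)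
    (ε : ℝ) (hε : 0 < ε) :
    ∃ R, ∀ z, R < ‖z‖ → ε * ‖z‖ ≤ ‖ℓ (complexRotation θ z)‖ →
      2 * ‖z‖ ≤ ‖(complexRotation θ)⁻¹ (f (complexRotation θ z))‖ := by
  obtain ⟨R, hR⟩ := hf (ε / 2) (by positivity)
  refine ⟨2 * R, fun z hz hz2 => ?_⟩
  -- In the sup norm a rotation and its inverse distort by a factor up to 2, so the two conjugating
  -- maps reduce 8 to 2.
  have h1 := norm_complexRotation_le θ z
  have h2 := norm_le_two_mul_norm_complexRotation θ z
  have h3 := norm_le_two_mul_norm_complexRotation_inv θ (f (complexRotation θ z))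
  have h4 := hR (complexRotation θ z) (by linarith) (by nlinarith)
  linarith

/-- Two independent linear forms control the norm. -/
theorem mul_norm_le_of_det {s κ : ℝ} {a b c d : ℝ} (ha : |a| ≤ 1) (hb : |b| ≤ 1) (hc : |c| ≤ 1)
    (hd : |d| ≤ 1) (hs : a * d - b * c = s) (hκ : κ ≤ |s|) (z : ℂ × ℂ) :
    κ * ‖z‖ ≤ ‖(a : ℂ) * z.1 + b * z.2‖ + ‖(c : ℂ) * z.1 + d * z.2‖ := by
  set p := (a : ℂ) * z.1 + b * z.2 with hp
  set q := (c : ℂ) * z.1 + d * z.2 with hq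
  have hs' : (a : ℂ) * d - b * c = s := by exact_mod_cast hs
  have key : ∀ (w : ℂ) (e g : ℝ), |e| ≤ 1 → |g| ≤ 1 → (s : ℂ) * w = e * p + g * q →
      κ * ‖w‖ ≤ ‖p‖ + ‖q‖ := by
    -- Cramer's rule: each coordinate times the determinant is a combination of p and q with
    -- coefficients bounded by 1.
    intro w e g he hg h
    have h1 : |s| * ‖w‖ = ‖(e : ℂ) * p + g * q‖ := by
      rw [← h, norm_mul, Complex.norm_real, Real.norm_eq_abs]
    have h2 : ‖(e : ℂ) * p + g * q‖ ≤ |e| * ‖p‖ + |g| * ‖q‖ := by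
      refine (norm_add_le _ _).trans_eq ?_
      simp
    have h3 := mul_le_mul_of_nonneg_right hκ (norm_nonneg w)
    have h4 := mul_le_of_le_one_left (norm_nonneg p) he
    have h5 := mul_le_of_le_one_left (norm_nonneg q) hg
    linarith
  rcases le_total ‖z.1‖ ‖z.2‖ with h | h
  · rw [Prod.norm_def, max_eq_right h]
    refine key _ (-c) a (by simpa using hc) ha ?_
    rw [← hs', hp, hq]; push_cast; ring
  · rw [Prod.norm_def, max_eq_left h]
    refine key _ d (-b) hd (by simpa using hb) ?_
    rw [← hs', hp, hq]; push_cast; ring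

/-- The four steps of the walk: `h₁`, `h₂` and their inverses. -/
noncomputable def henonStep (P : Polynomial ℂ) (δ : ℂ) (hδ : δ ≠ 0) (θ : ℝ) :
    Fin 4 → (ℂ × ℂ) ≃ₜ (ℂ × ℂ) :=
  ![henonMap P δ hδ, rotatedHenonMap P δ hδ θ, (henonMap P δ hδ)⁻¹, (rotatedHenonMap P δ hδ θ)⁻¹]

theorem henonStep_add_two (P : Polynomial ℂ) (δ : ℂ) (hδ : δ ≠ 0) (θ : ℝ) (i : Fin 4) :
    henonStep P δ hδ θ (i + 2) = (henonStep P δ hδ θ i)⁻¹ := by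
  fin_cases i <;> simp [henonStep]

theorem eq_sum_map_of_isStationaryMeasure {P : Polynomial ℂ} {δ : ℂ} {hδ : δ ≠ 0} {θ : ℝ}
    {a₁ a₂ a₃ a₄ : ℝ≥0} {μ : Measure (ℂ × ℂ)}
    (hμ : IsStationaryMeasure (stepMeasure P δ hδ θ a₁ a₂ a₃ a₄) μ) :
    μ = ∑ i, ![a₁, a₂, a₃, a₄] i • μ.map (henonStep P δ hδ θ i) := by
  ext B hB
  rw [hμ B hB, Fin.sum_univ_four, stepMeasure]
  simp only [lintegral_add_measure, lintegral_smul_measure]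
  rw [lintegral_dirac' _ measurable_from_top, lintegral_dirac' _ measurable_from_top,
    lintegral_dirac' _ measurable_from_top, lintegral_dirac' _ measurable_from_top]
  rfl

/-- The linear forms whose kernels are the directions at infinity where the steps of the walk
may fail to expand. -/
noncomputable def henonStepForm (θ : ℝ) : Fin 4 → ℂ × ℂ → ℂ :=
  ![fun z => z.2, fun z => (complexRotation θ z).2, fun z => z.1, fun z => (complexRotation θ z).1]

/-- The pairwise determinants of the four forms are ± sin θ, ± cos θ or ± 1. -/
theorem mul_norm_le_henonStepForm (θ : ℝ) (i j : Fin 4) (hij : i ≠ j) (z : ℂ × ℂ) :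
    min |Real.sin θ| |Real.cos θ| * ‖z‖ ≤ ‖henonStepForm θ i z‖ + ‖henonStepForm θ j z‖ := by
  set p : Fin 4 → ℝ := ![0, Real.sin θ, 1, Real.cos θ] with hp
  set q : Fin 4 → ℝ := ![1, Real.cos θ, 0, -Real.sin θ] with hq
  have hform : ∀ k, henonStepForm θ k z = p k * z.1 + q k * z.2 := by
    intro k
    fin_cases k <;> simp [henonStepForm, p, q, complexRotation_apply, sub_eq_add_neg]
  have hp1 : ∀ k, |p k| ≤ 1 := by
    intro k
    fin_cases k <;> simp [p, Real.abs_sin_le_one, Real.abs_cos_le_one]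
  have hq1 : ∀ k, |q k| ≤ 1 := by
    intro k
    fin_cases k <;> simp [q, Real.abs_sin_le_one, Real.abs_cos_le_one]
  have hsc : -(Real.sin θ * Real.sin θ) - Real.cos θ * Real.cos θ = -1 := by
    linarith [Real.sin_sq_add_cos_sq θ]
  have hcs : Real.cos θ * Real.cos θ + Real.sin θ * Real.sin θ = 1 := by
    linarith [Real.sin_sq_add_cos_sq θ]
  rw [hform, hform]
  refine mul_norm_le_of_det (hp1 i) (hq1 i) (hp1 j) (hq1 j) rfl ?_ z
  fin_cases i <;> fin_cases j <;>
    simp [p, q, Real.abs_sin_le_one, Real.abs_cos_le_one, hsc, hcs] at hij ⊢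

theorem exists_two_mul_norm_le_henonStep {P : Polynomial ℂ} (hP : 2 ≤ P.natDegree) {δ : ℂ}
    (hδ : δ ≠ 0) (θ : ℝ) (i : Fin 4) (ε : ℝ) (hε : 0 < ε) :
    ∃ R, ∀ z, R < ‖z‖ → ε * ‖z‖ ≤ ‖henonStepForm θ i z‖ →
      2 * ‖z‖ ≤ ‖henonStep P δ hδ θ i z‖ := by
  fin_cases i
  · exact exists_mul_norm_le_norm_henonMap hP hδ 2 hε
  · exact exists_two_mul_norm_le_of_conj θ (ℓ := Prod.snd)
      (fun ε hε => exists_mul_norm_le_norm_henonMap hP hδ 8 hε) ε hε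
  · exact exists_mul_norm_le_norm_henonMap_inv hP hδ 2 hε
  · exact exists_two_mul_norm_le_of_conj θ (ℓ := Prod.fst)
      (fun ε hε => exists_mul_norm_le_norm_henonMap_inv hP hδ 8 hε) ε hε

theorem sin_ne_zero_and_cos_ne_zero {θ : ℝ}
    (hθ : θ ∈ Set.Ioo 0 (2 * Real.pi) \ {Real.pi / 2, 3 * Real.pi / 2, Real.pi}) :
    Real.sin θ ≠ 0 ∧ Real.cos θ ≠ 0 := by
  obtain ⟨⟨h0, h2⟩, h⟩ := hθ
  simp only [Set.mem_insert_iff, Set.mem_singleton_iff, not_or] at h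
  have hpi := Real.pi_pos
  constructor
  · intro hs
    obtain ⟨n, hn⟩ := Real.sin_eq_zero_iff.1 hs
    have h3 : (0 : ℝ) < n := by by_contra!; nlinarith
    have h4 : (n : ℝ) < 2 := by by_contra!; nlinarith
    norm_cast at h3 h4
    obtain rfl : n = 1 := by omega
    exact h.2.2 (by rw [← hn]; simp)
  · intro hc
    obtain ⟨n, hn⟩ := Real.cos_eq_zero_iff.1 hc
    have h3 : (-1 : ℝ) < n := by by_contra!; nlinarith
    have h4 : (n : ℝ) < 2 := by by_contra!; nlinarith
    norm_cast at h4
    have h3' : (-1 : ℤ) < n := by exact_mod_cast h3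
    obtain rfl | rfl : n = 0 ∨ n = 1 := by omega
    · exact h.1 (by rw [hn]; simp)
    · exact h.2.1 (by rw [hn]; push_cast; ring)

/-! ### Invariance of null sets and conclusion -/

theorem measure_preimage_zpow_eq_zero {μ : Measure (ℂ × ℂ)} {h : (ℂ × ℂ) ≃ₜ (ℂ × ℂ)}
    (h₁ : ∀ B, MeasurableSet B → μ B = 0 → μ (h ⁻¹' B) = 0)
    (h₂ : ∀ B, MeasurableSet B → μ B = 0 → μ ((h⁻¹ : (ℂ × ℂ) ≃ₜ (ℂ × ℂ)) ⁻¹' B) = 0)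
    {B : Set (ℂ × ℂ)} (hB : MeasurableSet B) (hμB : μ B = 0) (n : ℤ) :
    μ ((h ^ n : (ℂ × ℂ) ≃ₜ (ℂ × ℂ)) ⁻¹' B) = 0 := by
  induction n with
  | zero => exact hμB
  | succ n ih =>
    rw [zpow_add_one]
    exact h₁ _ ((h ^ (n : ℤ)).continuous.measurable hB) ih
  | pred n ih =>
    rw [zpow_sub_one]
    exact h₂ _ ((h ^ (-n : ℤ)).continuous.measurable hB) ih

theorem exists_lt_norm_zpow_of_notMem_filledJuliaSet {h : (ℂ × ℂ) ≃ₜ (ℂ × ℂ)} {z : ℂ × ℂ}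
    (hz : z ∉ filledJuliaSet h) (R : ℝ) : ∃ n : ℤ, R < ‖(h ^ n) z‖ := by
  by_contra! hb
  refine hz ?_
  rw [filledJuliaSet, Set.mem_ofPred_eq, isBounded_iff_forall_norm_le]
  exact ⟨R, by rintro _ ⟨n, rfl⟩; exact hb n⟩

theorem theoremC (P : Polynomial ℂ) (hP : 2 ≤ P.natDegree) (δ : ℂ) (hδ : δ ≠ 0)
    (θ : ℝ) (hθ : θ ∈ Set.Ioo 0 (2 * Real.pi) \ {Real.pi / 2, 3 * Real.pi / 2, Real.pi})
    (a₁ a₂ a₃ a₄ : ℝ≥0) (ha₁ : 0 < a₁) (ha₂ : 0 < a₂) (ha₃ : 0 < a₃) (ha₄ : 0 < a₄)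
    (ha : a₁ + a₂ + a₃ + a₄ = 1)
    (hK : Disjoint (filledJuliaSet (henonMap P δ hδ))
      (filledJuliaSet (rotatedHenonMap P δ hδ θ))) :
    ¬ ∃ μ : Measure (ℂ × ℂ),
      IsProbabilityMeasure μ ∧ IsStationaryMeasure (stepMeasure P δ hδ θ a₁ a₂ a₃ a₄) μ := by
  rintro ⟨μ, hprob, hμ⟩
  have hstat := eq_sum_map_of_isStationaryMeasure hμ
  have hmeas : ∀ i, Measurable (henonStep P δ hδ θ i) := fun i =>
    (henonStep P δ hδ θ i).continuous.measurable
  obtain ⟨hs, hc⟩ := sin_ne_zero_and_cos_ne_zero hθ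
  obtain ⟨R, hR, hQ⟩ := exists_forall_ne_two_mul_norm_le
    (f := fun i => henonStep P δ hδ θ i) (lt_min (abs_pos.2 hs) (abs_pos.2 hc))
    (mul_norm_le_henonStepForm θ) (exists_two_mul_norm_le_henonStep hP hδ θ)
  obtain ⟨τ, κ, hκ1, hτ0, hτ1, hκ⟩ := exists_descent_weights a₁ a₂ a₃ a₄ ha₁ ha₂ ha₃ ha₄ ha
  have hF : μ {z | R < ‖z‖} = 0 :=
    measure_height_gt_eq_zero (f := fun i => henonStep P δ hδ θ i) (inv := fun i => i + 2)
      hmeas measurable_norm hR hτ0 hτ1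
      (fun i x => by simp [henonStep_add_two]) hQ (by simpa [Fin.sum_univ_four] using ha) hκ1 hκ
      hstat
  have hFm : MeasurableSet {z : ℂ × ℂ | R < ‖z‖} :=
    measurableSet_lt measurable_const measurable_norm
  -- Stationarity writes μ B as a sum of nonnegative terms with positive coefficients, so each term
  -- vanishes when μ B does.
  have hnull : ∀ i B, MeasurableSet B → μ B = 0 → μ (henonStep P δ hδ θ i ⁻¹' B) = 0 := by
    intro i B hB h0
    rw [hstat, Measure.finsetSum_apply, Finset.sum_eq_zero_iff] at h0
    have h1 := h0 i (Finset.mem_univ i)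
    have hai : ![a₁, a₂, a₃, a₄] i ≠ 0 := by
      fin_cases i <;> simp [ha₁.ne', ha₂.ne', ha₃.ne', ha₄.ne']
    rw [Measure.smul_apply, Measure.map_apply (hmeas i) hB] at h1
    exact (smul_eq_zero.1 h1).resolve_left hai
  have hcover : (Set.univ : Set (ℂ × ℂ)) ⊆
      (⋃ n : ℤ, (henonMap P δ hδ ^ n : (ℂ × ℂ) ≃ₜ (ℂ × ℂ)) ⁻¹' {z | R < ‖z‖}) ∪
      ⋃ n : ℤ, (rotatedHenonMap P δ hδ θ ^ n : (ℂ × ℂ) ≃ₜ (ℂ × ℂ)) ⁻¹' {z | R < ‖z‖} := by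
    intro z _
    by_cases hz : z ∈ filledJuliaSet (henonMap P δ hδ)
    · obtain ⟨n, hn⟩ := exists_lt_norm_zpow_of_notMem_filledJuliaSet
        (Set.disjoint_left.1 hK hz) R
      exact Or.inr (Set.mem_iUnion.2 ⟨n, hn⟩)
    · obtain ⟨n, hn⟩ := exists_lt_norm_zpow_of_notMem_filledJuliaSet hz R
      exact Or.inl (Set.mem_iUnion.2 ⟨n, hn⟩)
  have huniv : μ Set.univ = 0 := measure_mono_null hcover <| measure_union_null
    (measure_iUnion_null fun n => measure_preimage_zpow_eq_zero (hnull 0) (hnull 2) hFm hF n)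
    (measure_iUnion_null fun n => measure_preimage_zpow_eq_zero (hnull 1) (hnull 3) hFm hF n)
  rw [measure_univ] at huniv
  exact one_ne_zero huniv
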